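/- For a finite simple graph $G$ with vertex degrees $d_G(u)$, let \[\chi(G)=\sum_{uv\in E(G)}\frac{1}{\sqrt{d_G(u)+d_G(v)}}\] be its sum-connectivity index. A connected graph with $n$ vertices and $n+1$ edges is called bicyclic; let $\mathbb{B}(n)$ be the set of bicyclic graphs on $n$ vertices. Let $C_m$ denote the cycle on $m\ge 3$ vertices. Up to isomorphism, let - $\mathbf{B}_1^{(1)}(n)$ ($n\ge 6$) be the set of graphs obtained by joining two vertex-disjoint cycles $C_a$ and $C_b$ with $a+b=n$ by an edge; - $\mathbf{B}_1^{(2)}(n)$ ($n\ge 7$) be the set of graphs obtained by joining two vertex-disjoint cycles $C_a$ and $C_b$ with $a+b<n$ by a path of length $n-a-b+1$; - $\mathbf{B}_3^{(1)}(n)$ ($n\ge 4$) be the set of graphs obtained from $C_n$ by adding an edge; - $\mathbf{B}_3^{(2)}(n)$ ($n\ge 5$) be the set of graphs obtained by joining two non-adjacent vertices of $C_a$, where $4\le a\le n-1$, by a path of length $n-a+1$. (Here $\mathbf{B}_1^{(1)}(5)=\mathbf{B}_1^{(2)}(5)=\mathbf{B}_1^{(2)}(6)=\emptyset$.) Each of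 these families is non-empty in the indicated range of $n$. The second maximum of $\chi$ on $\mathbb{B}(n)$ is its largest value on $\mathbb{B}(n)$ that is different from the maximum. **Theorem.** Let $n\ge 5$. 1. If $n=5$, then the graphs in $\mathbb{B}(5)$ with the maximum $\chi$ are exactly those in $\mathbf{B}_3^{(1)}(5)$, and those with the second maximum $\chi$ are exactly those in $\mathbf{B}_3^{(2)}(5)$; each of these two sets consists of a single graph up to isomorphism. 2. If $n=6$, then the graphs in $\mathbb{B}(6)$ with the maximum $\chi$ are exactly those in $\mathbf{B}_1^{(1)}(6)\cup\mathbf{B}_3^{(1)}(6)$, and those with the second maximum $\chi$ are exactly those in $\mathbf{B}_3^{(2)}(6)$, which consists of a single graph up to isomorphism. 3. If $n\ge 7$, then the graphs in $\mathbb{B}(n)$ with the maximum $\chi$ are exactly those in $\mathbf{B}_1^{(1)}(n)\cup\mathbf{B}_3^{(1)}(n)$, and those with the second maximum $\chi$ are exactly those in $\mathbf{B}_1^{(2)}(n)\cup\mathbf{B}_3^{(2)}(n)$. Moreover, $\chi(G)=\frac{n-4}{2}+\frac{1}{\sqrt6}+\frac{4}{\sqrt5}$ for every $G\in\mathbf{B}_1^{(1)}(n)\cup\mathbf{B}_3^{(1)}(n)$,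 and $\chi(H)=\frac{n-5}{2}+\frac{6}{\sqrt5}$ for every $H\in\mathbf{B}_1^{(2)}(n)\cup\mathbf{B}_3^{(2)}(n)$. -/

import Mathlib

/-- The sum-connectivity index `χ(G) = ∑_{uv ∈ E(G)} 1 / √(d(u) + d(v))` of a finite simple graph. -/
noncomputable def sumConnectivityIndex {V : Type*} [Fintype V] (G : SimpleGraph V) : ℝ :=
  open Classical in
  ∑ e ∈ G.edgeFinset,
    Sym2.lift ⟨fun u v => 1 / √((G.degree u : ℝ) + (G.degree v : ℝ)),
      fun u v => by simp only [add_comm]⟩ e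

/-- The bicyclic graphs on `n` vertices: connected, with exactly `n + 1` edges. -/
def bicyclicGraphs (n : ℕ) : Set (SimpleGraph (Fin n)) :=
  {G | G.Connected ∧ G.edgeSet.ncard = n + 1}

/-- The vertices, in order, of a path from `x` to `y` with `k` new interior vertices. -/
def pathVertices {W : Type*} (x y : W) (k : ℕ) : Fin (k + 2) → W ⊕ Fin k :=
  Fin.cons (Sum.inl x) (Fin.snoc (α := fun _ => W ⊕ Fin k) Sum.inr (Sum.inl y))

/-- The graph obtained from `G` by joining its vertices `x` and `y` by a path of length `k + 1`,
whose `k` interior vertices are new. For `k = 0` this adds the edge `xy`. -/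
def joinByPath {W : Type*} (G : SimpleGraph W) (x y : W) (k : ℕ) : SimpleGraph (W ⊕ Fin k) :=
  G.map Function.Embedding.inl ⊔
    SimpleGraph.fromEdgeSet
      {e | ∃ i : Fin (k + 1), e = s(pathVertices x y k i.castSucc, pathVertices x y k i.succ)}

/-- `B₁⁽¹⁾(n)`: two vertex-disjoint cycles `C_a`, `C_b` with `a + b = n`, joined by an edge. -/
def familyB11 (n : ℕ) : Set (SimpleGraph (Fin n)) :=
  {G | ∃ a b : ℕ, 3 ≤ a ∧ 3 ≤ b ∧ a + b = n ∧ ∃ (u : Fin a) (v : Fin b),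
    Nonempty (G ≃g joinByPath (SimpleGraph.cycleGraph a ⊕g SimpleGraph.cycleGraph b)
      (Sum.inl u) (Sum.inr v) 0)}

/-- `B₁⁽²⁾(n)`: two vertex-disjoint cycles `C_a`, `C_b` with `a + b < n`, joined by a path of
length `n - a - b + 1`. -/
def familyB12 (n : ℕ) : Set (SimpleGraph (Fin n)) :=
  {G | ∃ a b : ℕ, 3 ≤ a ∧ 3 ≤ b ∧ a + b < n ∧ ∃ (u : Fin a) (v : Fin b),
    Nonempty (G ≃g joinByPath (SimpleGraph.cycleGraph a ⊕g SimpleGraph.cycleGraph b)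
      (Sum.inl u) (Sum.inr v) (n - a - b))}

/-- `B₃⁽¹⁾(n)`: the cycle `C_n` with one added edge. -/
def familyB31 (n : ℕ) : Set (SimpleGraph (Fin n)) :=
  {G | 4 ≤ n ∧ ∃ x y : Fin n, x ≠ y ∧ ¬ (SimpleGraph.cycleGraph n).Adj x y ∧
    Nonempty (G ≃g SimpleGraph.cycleGraph n ⊔ SimpleGraph.edge x y)}

/-- `B₃⁽²⁾(n)`: a cycle `C_a` with `4 ≤ a ≤ n - 1`, two of whose non-adjacent vertices are joined
by a path of length `n - a + 1`. -/
def familyB32 (n : ℕ) : Set (SimpleGraph (Fin n)) :=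
  {G | ∃ a : ℕ, 4 ≤ a ∧ a < n ∧ ∃ x y : Fin a, x ≠ y ∧ ¬ (SimpleGraph.cycleGraph a).Adj x y ∧
    Nonempty (G ≃g joinByPath (SimpleGraph.cycleGraph a) x y (n - a))}

/-- The graphs in `S` whose sum-connectivity index is maximum among the graphs in `S`. -/
def indexMaximizers {V : Type*} [Fintype V] (S : Set (SimpleGraph V)) : Set (SimpleGraph V) :=
  {G | G ∈ S ∧ ∀ H ∈ S, sumConnectivityIndex H ≤ sumConnectivityIndex G}

/-- The graphs in `S` whose sum-connectivity index is the second maximum among the graphs in `S`,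
that is, the largest value that is different from the maximum. -/
def indexSecondMaximizers {V : Type*} [Fintype V] (S : Set (SimpleGraph V)) :
    Set (SimpleGraph V) :=
  indexMaximizers (S \ indexMaximizers S)

/-- All graphs in `S` are isomorphic to each other. -/
def UniqueUpToIso {V : Type*} (S : Set (SimpleGraph V)) : Prop :=
  ∀ G ∈ S, ∀ H ∈ S, Nonempty (G ≃g H)

/-! An edge between two vertices of valency `2` contributes `1/2`, so the index is compared with
`m/2`, where `m = n + 1` is the number of edges. If each edge satisfies `1/√(d(a)+d(b)) ≤ 1/2 + h(a)
+ h(b)`, summation over the edges gives `χ(G) ≤ m/2 + ∑ d(v) h(v)`; with equality on edges it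
computes `χ(G)`. In a bicyclic graph `∑ (d(v) - 2) = 2`, which leaves three cases.

If there is a pendant vertex, a weight making `d h(d)` linear in `d` for `d ≥ 2` gives `χ ≤ m/2 -
0.325` (`sumConnectivityIndex_le_of_pendant`). If one vertex has valency `4` and the rest `2`, then
`χ ≤ m/2 + 4(1/√6 - 1/2)`. Otherwise two vertices have valency `3` and the rest `2` (`IsTwoThree`),
and `χ` depends only on `n` and on whether those two are adjacent. Both values exceed the bounds in
the other cases, and the adjacent case is the larger.

It remains to recognise the families. Deleting a shortest path between the two vertices of valency
`3` leaves valencies `0` and `2`. The ends of the path lie on one common cycle or on two disjoint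
ones, so the graph is a theta graph or a dumbbell (`IsTwoThree.exists_iso`); adjacency means that
the path is a single edge. -/

open SimpleGraph

/-! ### Valencies and the edgewise estimate of the index -/

section Valency

variable {V W : Type*}

/-- The number of neighbours of a vertex. -/
noncomputable def valency (G : SimpleGraph V) (v : V) : ℕ := (G.neighborSet v).ncard

theorem degree_eq_valency (G : SimpleGraph V) (v : V) [Fintype (G.neighborSet v)] :
    G.degree v = valency G v := by
  rw [valency, Set.ncard_eq_toFinset_card', ← card_neighborFinset_eq_degree]
  rfl

theorem card_edgeFinset_eq_ncard (G : SimpleGraph V) [Fintype G.edgeSet] :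
    G.edgeFinset.card = G.edgeSet.ncard := by
  rw [Set.ncard_eq_toFinset_card']; rfl

theorem valency_iso {G : SimpleGraph V} {H : SimpleGraph W} (f : G ≃g H) (v : V) :
    valency H (f v) = valency G v := by
  unfold valency
  rw [← Set.ncard_image_of_injective (G.neighborSet v) f.injective]
  congr 1
  ext w
  simp only [mem_neighborSet, Set.mem_image]
  constructor
  · intro h
    exact ⟨f.symm w, by simpa using f.symm.map_rel_iff.2 h, by simp⟩
  · rintro ⟨x, hx, rfl⟩
    exact f.map_rel_iff.2 hx

variable [Fintype V]

theorem sum_valency (G : SimpleGraph V) : ∑ v, valency G v = 2 * G.edgeSet.ncard := by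
  classical
  rw [← card_edgeFinset_eq_ncard, ← sum_degrees_eq_twice_card_edges]
  simp [degree_eq_valency]

theorem valency_pos {G : SimpleGraph V} (hG : G.Connected) (hV : 2 ≤ Fintype.card V) (v : V) :
    1 ≤ valency G v := by
  classical
  rw [← degree_eq_valency]
  have : Nontrivial V := Fintype.one_lt_card_iff_nontrivial.1 hV
  exact hG.preconnected.degree_pos_of_nontrivial v

open Classical in
/-- Summing `h` over the endpoints of all edges counts each vertex as often as its valency. -/
theorem sum_edge_endpoints (G : SimpleGraph V) (h : V → ℝ) :
    ∑ e ∈ G.edgeFinset, Sym2.lift ⟨fun u v => h u + h v, fun _ _ => add_comm _ _⟩ e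
      = ∑ v, (valency G v : ℝ) * h v := by
  have key : ∀ e ∈ G.edgeFinset, Sym2.lift ⟨fun u v => h u + h v, fun u v => add_comm _ _⟩ e
      = ∑ v, if v ∈ e then h v else 0 := by
    intro e
    induction e with | _ a b
    intro he
    have hab : a ≠ b := (by simpa using he : G.Adj a b).ne
    rw [← Finset.sum_filter]
    have : (Finset.univ.filter fun v => v ∈ s(a, b)) = {a, b} := by ext; simp
    rw [this, Finset.sum_pair hab]
    rfl
  rw [Finset.sum_congr rfl key, Finset.sum_comm]
  refine Finset.sum_congr rfl fun v _ => ?_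
  rw [← Finset.sum_filter, Finset.sum_const, nsmul_eq_mul, ← degree_eq_valency,
    ← card_incidenceFinset_eq_degree, incidenceFinset_eq_filter]

/-- An edgewise upper bound by a function of the endpoints bounds the index. -/
theorem sumConnectivityIndex_le (G : SimpleGraph V) (h : V → ℝ)
    (H : ∀ a b, G.Adj a b →
      1 / √((valency G a : ℝ) + valency G b) ≤ 1 / 2 + h a + h b) :
    sumConnectivityIndex G ≤ (G.edgeSet.ncard : ℝ) / 2 + ∑ v, (valency G v : ℝ) * h v := by
  classical
  rw [← sum_edge_endpoints, ← card_edgeFinset_eq_ncard, div_eq_mul_one_div, ← nsmul_eq_mul,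
    ← Finset.sum_const, ← Finset.sum_add_distrib]
  unfold sumConnectivityIndex
  refine (Finset.sum_le_sum (g := fun e => 1 / 2 +
    Sym2.lift ⟨fun u v => h u + h v, fun u v => add_comm _ _⟩ e) (fun e => ?_)).trans
    (le_of_eq ?_)
  · induction e with | _ a b
    intro he
    have := H a b (by simpa using he)
    simpa only [Sym2.lift_mk, degree_eq_valency, ← add_assoc] using this
  · congr!

/-- An edgewise formula by a function of the endpoints, up to a correction at one pair, computes
the index. -/
theorem sumConnectivityIndex_eq (G : SimpleGraph V) (h : V → ℝ) (u v : V) (δ : ℝ)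
    [Decidable (G.Adj u v)]
    (H : ∀ a b, G.Adj a b → 1 / √((valency G a : ℝ) + valency G b) = 1 / 2 + h a + h b +
      open Classical in if s(a, b) = s(u, v) then δ else 0) :
    sumConnectivityIndex G = (G.edgeSet.ncard : ℝ) / 2 + ∑ v, (valency G v : ℝ) * h v +
      if G.Adj u v then δ else 0 := by
  classical
  have h2 : (if G.Adj u v then δ else 0) =
      ∑ e ∈ G.edgeFinset, if e = s(u, v) then δ else 0 := by
    rw [Finset.sum_ite_eq']
    simp
  rw [h2, ← sum_edge_endpoints, ← card_edgeFinset_eq_ncard, div_eq_mul_one_div, ← nsmul_eq_mul,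
    ← Finset.sum_const, ← Finset.sum_add_distrib, ← Finset.sum_add_distrib]
  unfold sumConnectivityIndex
  refine Eq.trans (Finset.sum_congr rfl (g := fun e => 1 / 2 +
    Sym2.lift ⟨fun u v => h u + h v, fun u v => add_comm _ _⟩ e + if e = s(u, v) then δ else 0)
    (fun e => ?_)) ?_
  · induction e with | _ a b
    intro he
    have := H a b (by simpa using he)
    simp only [Sym2.lift_mk, degree_eq_valency, ← add_assoc]
    rw [this]
  · congr!

end Valency

/-! ### The index of graphs with two vertices of valency 3 and the rest of valency 2 -/

section Extremal

variable {V : Type*}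

/-- A connected graph all of whose vertices have valency `2`, except for two vertices `u ≠ v` of
valency `3`. -/
structure IsTwoThree (G : SimpleGraph V) (u v : V) : Prop where
  connected : G.Connected
  ne : u ≠ v
  left : valency G u = 3
  right : valency G v = 3
  other : ∀ w, w ≠ u → w ≠ v → valency G w = 2

theorem IsTwoThree.of_iso {W : Type*} {G : SimpleGraph V} {H : SimpleGraph W} {u v : V}
    (h : IsTwoThree G u v) (f : G ≃g H) : IsTwoThree H (f u) (f v) where
  connected := f.connected_iff.1 h.connected
  ne := f.injective.ne h.ne
  left := by rw [valency_iso, h.left]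
  right := by rw [valency_iso, h.right]
  other w hu hv := by
    rw [← f.apply_symm_apply w, valency_iso]
    exact h.other _ (fun e => hu (by rw [← e]; simp)) (fun e => hv (by rw [← e]; simp))

variable [Fintype V]

theorem IsTwoThree.ncard_edgeSet {G : SimpleGraph V} {u v : V} (h : IsTwoThree G u v) :
    G.edgeSet.ncard = Fintype.card V + 1 := by
  classical
  have h1 := sum_valency G
  have h2 : ∑ w, valency G w = ∑ w, (2 + (if w = u then 1 else 0) + if w = v then 1 else 0) := by
    refine Finset.sum_congr rfl fun w _ => ?_
    have := h.ne
    by_cases hu : w = u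
    · subst hu; simp [h.left, this]
    · by_cases hv : w = v
      · subst hv; simp [h.right, hu]
      · simp [hu, hv, h.other w hu hv]
  simp [Finset.sum_add_distrib] at h2
  omega

/-- Each of the six incidences at `u` and `v` shifts an edge from `1/2` to `1/√5`. An edge `uv` is
shifted twice but should contribute `1/√6`; the last term corrects this. -/
theorem IsTwoThree.sumConnectivityIndex_eq {G : SimpleGraph V} {u v : V} (h : IsTwoThree G u v)
    [Decidable (G.Adj u v)] :
    sumConnectivityIndex G = ((Fintype.card V : ℝ) + 1) / 2 + 6 * (1 / √5 - 1 / 2) +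
      if G.Adj u v then 1 / √6 - 1 / 2 - 2 * (1 / √5 - 1 / 2) else 0 := by
  classical
  have huv := h.ne
  have hvu := h.ne.symm
  have hl := h.left
  have hr := h.right
  have ho := h.other
  have h4 : √(4 : ℝ) = 2 := by
    rw [show (4 : ℝ) = 2 ^ 2 by norm_num]; exact Real.sqrt_sq (by norm_num)
  rw [_root_.sumConnectivityIndex_eq G
    (fun w => if w = u then 1 / √5 - 1 / 2 else if w = v then 1 / √5 - 1 / 2 else 0) u v
    (1 / √6 - 1 / 2 - 2 * (1 / √5 - 1 / 2)), h.ncard_edgeSet]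
  · congr 1
    push_cast
    congr 1
    rw [← Finset.sum_subset (Finset.subset_univ {u, v}), Finset.sum_pair huv]
    · simp [hl, hr, hvu]; ring
    · intro x _ hx
      simp only [Finset.mem_insert, Finset.mem_singleton, not_or] at hx
      simp [hx]
  · intro a b hab
    have hne := hab.ne
    by_cases hau : a = u
    · subst hau
      by_cases hbv : b = v
      · subst hbv
        simp [hl, hr, hvu]; norm_num; ring
      · have := ho b hne.symm hbv
        simp [hl, this, hne.symm, hbv, huv]; norm_num
    · by_cases hav : a = v
      · subst hav
        by_cases hbu : b = u
        · subst hbu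
          simp [hl, hr, hvu]; norm_num; ring
        · have := ho b hbu hne.symm
          simp [hr, this, hne.symm, hbu, hvu]; norm_num
      · have ha := ho a hau hav
        by_cases hbu : b = u
        · subst hbu
          simp [hl, ha, hne, hav]; norm_num
        · by_cases hbv : b = v
          · subst hbv
            simp [hr, ha, hau, hne, hbu]; norm_num
          · have := ho b hbu hbv
            simp [this, ha, hau, hav, hbu, hbv]; norm_num [h4]

end Extremal

/-! ### Upper bounds for all other bicyclic graphs -/

section Bound

/-- In a connected graph a non-empty set of vertices closed under adjacency is everything. -/
theorem mem_of_closed {V : Type*} {G : SimpleGraph V} (hG : G.Preconnected) {S : Set V} {a : V}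
    (ha : a ∈ S) (hS : ∀ x ∈ S, ∀ y, G.Adj x y → y ∈ S) (b : V) : b ∈ S := by
  obtain ⟨p⟩ := hG a b
  induction p with
  | nil => exact ha
  | cons h _ ih => exact ih (hS _ ha _ h)

/-- The endpoint weight used to bound the index of graphs with a pendant vertex. -/
noncomputable def pendantWeight (d : ℕ) : ℝ := if d = 1 then 0.08 else 0.135 * (2 / (d : ℝ) - 1)

theorem one_div_sqrt_le_of {s t : ℝ} (ht : 0 < t) (hs : 1 ≤ s * t ^ 2) : 1 / √s ≤ t := by
  have hs0 : 0 < s := by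
    by_contra! h
    nlinarith [sq_nonneg t, mul_nonneg (neg_nonneg.2 h) (sq_nonneg t)]
  have h1 : 0 < √s := Real.sqrt_pos.2 hs0
  rw [div_le_iff₀ h1]
  have h2 : (t * √s) ^ 2 = s * t ^ 2 := by rw [mul_pow, Real.sq_sqrt hs0.le]; ring
  have h3 : 0 < t * √s := by positivity
  nlinarith

theorem one_div_sqrt_le_pendantWeight_of_one {y : ℕ} (hy : 2 ≤ y) :
    1 / √((1 : ℝ) + y) ≤ 1 / 2 + pendantWeight 1 + pendantWeight y := by
  have hy' : (2 : ℝ) ≤ y := by exact_mod_cast hy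
  have hy1 : y ≠ 1 := by omega
  simp only [pendantWeight, if_true, hy1, if_false]
  by_cases h2 : y = 2
  · subst h2; norm_num; rw [← one_div]; apply one_div_sqrt_le_of <;> norm_num
  by_cases h3 : y = 3
  · subst h3; norm_num
  by_cases h4 : y = 4
  · subst h4; norm_num; rw [← one_div]; apply one_div_sqrt_le_of <;> norm_num
  have h5 : (5 : ℝ) ≤ y := by exact_mod_cast (by omega : 5 ≤ y)
  -- `0.445 = 0.5 + 0.08 - 0.135` is the limit of the right-hand side as `y` grows, hence a lower
  -- bound for it.
  have : 1 / √((1 : ℝ) + y) ≤ 0.445 := by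
    apply one_div_sqrt_le_of <;> norm_num; linarith
  have h6 : (0 : ℝ) ≤ 2 / y := by positivity
  norm_num at *
  linarith

theorem one_div_sqrt_le_pendantWeight_of_two {x y : ℕ} (hx : 2 ≤ x) (hy : 2 ≤ y) :
    1 / √((x : ℝ) + y) ≤ 1 / 2 + pendantWeight x + pendantWeight y := by
  have hx' : (2 : ℝ) ≤ x := by exact_mod_cast hx
  have hy' : (2 : ℝ) ≤ y := by exact_mod_cast hy
  have hx1 : x ≠ 1 := by omega
  have hy1 : y ≠ 1 := by omega
  simp only [pendantWeight, hx1, hy1, if_false]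
  -- This sum escapes the convexity argument below: `1/√5` lies strictly between the roots `23/54`
  -- and `1/2` found there.
  by_cases h5 : x + y = 5
  · have : (x = 2 ∧ y = 3) ∨ (x = 3 ∧ y = 2) := by omega
    rcases this with ⟨rfl, rfl⟩ | ⟨rfl, rfl⟩ <;> norm_num <;> rw [← one_div] <;>
      apply one_div_sqrt_le_of <;> norm_num
  have hxy : 2 / (x : ℝ) + 2 / y ≥ 8 / (x + y) := by
    rw [ge_iff_le, div_add_div _ _ (by positivity) (by positivity),
      div_le_div_iff₀ (by positivity) (by positivity)]
    nlinarith [sq_nonneg ((x : ℝ) - y)]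
  have hs : (4 : ℝ) ≤ x + y := by linarith
  set s : ℝ := (x : ℝ) + y with hsdef
  have hs0 : 0 < √s := Real.sqrt_pos.2 (by linarith)
  set t := 1 / √s with ht
  have hts : 8 / s = 8 * t ^ 2 := by
    rw [ht, div_pow, Real.sq_sqrt (by linarith)]; ring
  have h2 : t ≤ 1 / 2 := by
    apply one_div_sqrt_le_of <;> norm_num; linarith
  -- Since `2/x + 2/y ≥ 8 t ^ 2`, it suffices that `1.08 t ^ 2 - t + 0.23 ≥ 0`, whose left side is
  -- `1.08` times this product.
  have key : 0 ≤ (1 / 2 - t) * (23 / 54 - t) := by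
    by_cases h4 : x + y = 4
    · have : s = 4 := by rw [hsdef]; exact_mod_cast h4
      have : t = 1 / 2 := by
        rw [ht, this, show (4 : ℝ) = 2 ^ 2 by norm_num, Real.sqrt_sq (by norm_num)]
      rw [this]; norm_num
    · have h6 : (6 : ℝ) ≤ s := by rw [hsdef]; exact_mod_cast (by omega : 6 ≤ x + y)
      have : t ≤ 23 / 54 := by
        apply one_div_sqrt_le_of <;> norm_num; linarith
      exact mul_nonneg (by linarith) (by linarith)
  norm_num at *
  nlinarith

theorem one_div_sqrt_le_pendantWeight {x y : ℕ} (hx : 1 ≤ x) (hy : 1 ≤ y)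
    (hxy : ¬ (x = 1 ∧ y = 1)) :
    1 / √((x : ℝ) + y) ≤ 1 / 2 + pendantWeight x + pendantWeight y := by
  by_cases h1 : x = 1
  · subst h1
    simpa using one_div_sqrt_le_pendantWeight_of_one (y := y) (by omega)
  by_cases h2 : y = 1
  · subst h2
    have := one_div_sqrt_le_pendantWeight_of_one (y := x) (by omega)
    rw [add_comm] at this
    push_cast
    linarith
  exact one_div_sqrt_le_pendantWeight_of_two (by omega) (by omega)

variable {V : Type*} [Fintype V]

/-- Two adjacent pendant vertices would form a whole component. This excludes the one pair of
valencies for which the bound by `pendantWeight` fails. -/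
theorem not_both_pendant {G : SimpleGraph V} (hG : G.Connected) (hV : 3 ≤ Fintype.card V)
    {a b : V} (hab : G.Adj a b) : ¬ (valency G a = 1 ∧ valency G b = 1) := by
  classical
  rintro ⟨ha, hb⟩
  obtain ⟨x, hx⟩ := Set.ncard_eq_one.1 ha
  obtain ⟨y, hy⟩ := Set.ncard_eq_one.1 hb
  have hbx : b = x := by
    have : b ∈ G.neighborSet a := hab
    simpa [hx] using this
  have hay : a = y := by
    have : a ∈ G.neighborSet b := hab.symm
    simpa [hy] using this
  subst hbx hay
  have := mem_of_closed hG.preconnected (S := {a, b}) (a := a) (by simp) (by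
    rintro z (rfl | rfl) w hw
    · have : w ∈ G.neighborSet z := hw
      rw [hx] at this; exact Or.inr this
    · have : w ∈ G.neighborSet z := hw
      rw [hy] at this; exact Or.inl this)
  have h2 : Fintype.card V ≤ ({a, b} : Finset V).card :=
    Finset.card_le_card fun z _ => by simpa using this z
  have := Finset.card_le_two (a := a) (b := b)
  omega

theorem sumConnectivityIndex_le_of_pendant {G : SimpleGraph V} (hG : G.Connected)
    (hE : G.edgeSet.ncard = Fintype.card V + 1) (hV : 3 ≤ Fintype.card V) {p : V}
    (hp : valency G p = 1) :
    sumConnectivityIndex G ≤ ((Fintype.card V : ℝ) + 1) / 2 - 0.325 := by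
  classical
  refine (sumConnectivityIndex_le G (fun w => pendantWeight (valency G w)) fun a b hab =>
    one_div_sqrt_le_pendantWeight (valency_pos hG (by omega) a) (valency_pos hG (by omega) b)
      (not_both_pendant hG hV hab)).trans ?_
  -- The product `d * pendantWeight d` equals `0.135 (2 - d)` for `d ≥ 2` and is smaller by `0.055 =
  -- 0.135 - 0.08` for `d = 1`. Only the deficit at `p` is kept; the total is `-0.27 - 0.055`.
  have h1 : ∑ v, (valency G v : ℝ) * pendantWeight (valency G v) ≤
      ∑ v, (0.135 * (2 - (valency G v : ℝ)) - if v = p then 0.055 else 0) := by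
    refine Finset.sum_le_sum fun v _ => ?_
    by_cases hv : valency G v = 1
    · by_cases hvp : v = p
      · subst hvp; simp [hp, pendantWeight]; norm_num
      · simp [hv, pendantWeight, hvp]; norm_num
    · have hvp : v ≠ p := fun h => hv (h ▸ hp)
      have : (valency G v : ℝ) ≠ 0 := by
        have := valency_pos hG (by omega) v
        positivity
      simp only [pendantWeight, hv, hvp, if_false]
      field_simp
      linarith
  have h2 : ∑ v, (valency G v : ℝ) = 2 * (Fintype.card V + 1) := by
    have := sum_valency G
    rw [hE] at this
    exact_mod_cast this
  rw [Finset.sum_sub_distrib, ← Finset.mul_sum, Finset.sum_sub_distrib, h2] at h1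
  simp at h1
  rw [hE]
  push_cast
  norm_num at *
  linarith

theorem sumConnectivityIndex_le_of_four {G : SimpleGraph V}
    (hE : G.edgeSet.ncard = Fintype.card V + 1) {p : V}
    (hp : valency G p = 4) (ho : ∀ w, w ≠ p → valency G w = 2) :
    sumConnectivityIndex G ≤ ((Fintype.card V : ℝ) + 1) / 2 + 4 * (1 / √6 - 1 / 2) := by
  classical
  have h4 : √(4 : ℝ) = 2 := by
    rw [show (4 : ℝ) = 2 ^ 2 by norm_num]; exact Real.sqrt_sq (by norm_num)
  refine (sumConnectivityIndex_le G (fun w => if w = p then 1 / √6 - 1 / 2 else 0)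
    fun a b hab => ?_).trans ?_
  · have hne := hab.ne
    by_cases ha : a = p
    · subst ha
      simp [hp, ho b hne.symm, hne.symm]; norm_num
    · by_cases hb : b = p
      · subst hb
        simp [hp, ho a ha, ha]; norm_num
      · simp [ho a ha, ho b hb, ha, hb]; norm_num [h4]
  · simp [hE, hp]

/-- The excesses `valency - 2` are natural numbers with sum `2`, so they are either a single `2` or
two `1`s. -/
theorem exists_isTwoThree_or_four {G : SimpleGraph V} (hG : G.Connected)
    (hE : G.edgeSet.ncard = Fintype.card V + 1) (h2 : ∀ v, 2 ≤ valency G v) :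
    (∃ u v, IsTwoThree G u v) ∨ ∃ p, valency G p = 4 ∧ ∀ w, w ≠ p → valency G w = 2 := by
  classical
  have hs : ∑ v, (valency G v - 2) = 2 := by
    have h := sum_valency G
    have h' : ∑ v, valency G v = ∑ v, (valency G v - 2) + ∑ _v : V, 2 := by
      rw [← Finset.sum_add_distrib]
      exact Finset.sum_congr rfl fun v _ => by have := h2 v; omega
    simp at h'
    omega
  have split := fun p => Finset.add_sum_erase Finset.univ (fun v => valency G v - 2)
    (Finset.mem_univ p)
  by_cases h4 : ∃ p, 4 ≤ valency G p
  · obtain ⟨p, hp⟩ := h4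
    right
    have hsp := split p
    have h0 : ∑ v ∈ Finset.univ.erase p, (valency G v - 2) = 0 := by omega
    refine ⟨p, by omega, fun w hw => ?_⟩
    have := (Finset.sum_eq_zero_iff.1 h0) w (by simp [hw])
    have := h2 w
    omega
  · push Not at h4
    left
    -- All valencies are now `2` or `3`, so the excess is the indicator of valency `3`.
    have hc : (Finset.univ.filter fun v => valency G v = 3).card = 2 := by
      rw [Finset.card_filter, ← hs]
      refine Finset.sum_congr rfl fun v _ => ?_
      have := h2 v
      have := h4 v
      split_ifs <;> omega
    obtain ⟨u, v, huv, he⟩ := Finset.card_eq_two.1 hc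
    have hm : ∀ w, valency G w = 3 ↔ w = u ∨ w = v := fun w => by
      have : w ∈ (Finset.univ.filter fun v => valency G v = 3) ↔ w ∈ ({u, v} : Finset V) := by
        rw [he]
      simpa using this
    refine ⟨u, v, hG, huv, (hm u).2 (by simp), (hm v).2 (by simp), fun w hu hv => ?_⟩
    have := h2 w
    have := h4 w
    have : valency G w ≠ 3 := fun h => by simpa [hu, hv] using (hm w).1 h
    omega

theorem le_one_div_sqrt_five : 0.4472 ≤ 1 / √(5 : ℝ) := by
  rw [le_div_iff₀ (by positivity)]
  have : √(5 : ℝ) ≤ 2.23609 := Real.sqrt_le_iff.2 (by norm_num)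
  norm_num at *
  linarith

theorem one_div_sqrt_five_le : 1 / √(5 : ℝ) ≤ 0.44722 := by
  apply one_div_sqrt_le_of <;> norm_num

theorem le_one_div_sqrt_six : 0.408 ≤ 1 / √(6 : ℝ) := by
  rw [le_div_iff₀ (by positivity)]
  have : √(6 : ℝ) ≤ 2.45 := Real.sqrt_le_iff.2 (by norm_num)
  norm_num at *
  linarith

theorem one_div_sqrt_six_le : 1 / √(6 : ℝ) ≤ 0.4083 := by
  apply one_div_sqrt_le_of <;> norm_num

/-- Relative to `m/2`, the pendant bound is `-0.325` and the valency `4` bound is about `-0.367`,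
against about `-0.317` on the right. -/
theorem sumConnectivityIndex_lt_of_not_isTwoThree {G : SimpleGraph V} (hG : G.Connected)
    (hE : G.edgeSet.ncard = Fintype.card V + 1) (hV : 3 ≤ Fintype.card V)
    (hn : ¬ ∃ u v, IsTwoThree G u v) :
    sumConnectivityIndex G < ((Fintype.card V : ℝ) + 1) / 2 + 6 * (1 / √5 - 1 / 2) := by
  have h5 := le_one_div_sqrt_five
  by_cases hp : ∃ p, valency G p = 1
  · obtain ⟨p, hp⟩ := hp
    have := sumConnectivityIndex_le_of_pendant hG hE hV hp
    norm_num at *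
    linarith
  · push Not at hp
    rcases exists_isTwoThree_or_four hG hE (fun v => by
      have := valency_pos hG (by omega) v
      have := hp v
      omega) with h | ⟨p, hp, ho⟩
    · exact absurd h hn
    · have := sumConnectivityIndex_le_of_four hE hp ho
      have := one_div_sqrt_six_le
      norm_num at *
      linarith

end Bound

/-! ### Joining two vertices by a path -/

section JoinByPath

variable {V W : Type*}

/-- An injective homomorphism that does not increase valencies, into a connected graph, is an
isomorphism. -/
theorem nonempty_iso_of_injective_hom [Finite V] [Nonempty W] {F : SimpleGraph W}
    {G : SimpleGraph V} (hG : G.Preconnected) (φ : W → V) (hφ : Function.Injective φ)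
    (hom : ∀ a b, F.Adj a b → G.Adj (φ a) (φ b)) (hval : ∀ w, valency G (φ w) ≤ valency F w) :
    Nonempty (F ≃g G) := by
  -- The image of a neighbourhood fits inside the target one and is at least as large, so they
  -- agree. Hence the range of `φ` is closed under adjacency, and connectedness gives surjectivity.
  have hN : ∀ w, φ '' F.neighborSet w = G.neighborSet (φ w) := fun w => by
    refine Set.eq_of_subset_of_ncard_le ?_ ?_ (Set.toFinite _)
    · rintro _ ⟨x, hx, rfl⟩
      exact hom _ _ hx
    · rw [Set.ncard_image_of_injective _ hφ]
      exact hval w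
  have hsurj : Function.Surjective φ := fun v => by
    refine mem_of_closed hG (S := Set.range φ) (a := φ (Classical.arbitrary W)) ⟨_, rfl⟩ ?_ v
    rintro _ ⟨w, rfl⟩ y hy
    have : y ∈ G.neighborSet (φ w) := hy
    rw [← hN w] at this
    obtain ⟨x, -, rfl⟩ := this
    exact ⟨x, rfl⟩
  refine ⟨⟨Equiv.ofBijective φ ⟨hφ, hsurj⟩, fun {a b} => ⟨fun h => ?_, hom a b⟩⟩⟩
  have : φ b ∈ G.neighborSet (φ a) := h
  rw [← hN a] at this
  obtain ⟨x, hx, hxb⟩ := this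
  exact hφ hxb ▸ hx

theorem pathVertices_zero (x y : W) (k : ℕ) : pathVertices x y k 0 = Sum.inl x := rfl

theorem pathVertices_last (x y : W) (k : ℕ) :
    pathVertices x y k (Fin.last (k + 1)) = Sum.inl y := by
  rw [← Fin.succ_last, pathVertices, Fin.cons_succ, Fin.snoc_last]

theorem pathVertices_mid (x y : W) (k : ℕ) (j : Fin k) :
    pathVertices x y k j.castSucc.succ = Sum.inr j := by
  rw [pathVertices, Fin.cons_succ, Fin.snoc_castSucc]

theorem pathVertices_cases {k : ℕ} (i : Fin (k + 2)) :
    i = 0 ∨ i = Fin.last (k + 1) ∨ ∃ j : Fin k, i = j.castSucc.succ := by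
  obtain rfl | ⟨i, rfl⟩ := i.eq_zero_or_eq_succ
  · exact Or.inl rfl
  · obtain ⟨j, rfl⟩ | rfl := i.eq_castSucc_or_eq_last
    · exact Or.inr (Or.inr ⟨j, rfl⟩)
    · exact Or.inr (Or.inl rfl)

theorem pathVertices_injective {x y : W} (hxy : x ≠ y) (k : ℕ) :
    Function.Injective (pathVertices x y k) := by
  intro i i' h
  rcases pathVertices_cases i with rfl | rfl | ⟨j, rfl⟩ <;>
  rcases pathVertices_cases i' with rfl | rfl | ⟨j', rfl⟩ <;>
  simp only [pathVertices_zero, pathVertices_last, pathVertices_mid, Sum.inl.injEq, Sum.inr.injEq,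
    reduceCtorEq] at h <;> first | rfl | exact absurd h hxy | exact absurd h.symm hxy | rw [h]

theorem joinByPath_adj {G : SimpleGraph W} {x y : W} (hxy : x ≠ y) {k : ℕ} {a b : W ⊕ Fin k} :
    (joinByPath G x y k).Adj a b ↔ (∃ a' b', G.Adj a' b' ∧ Sum.inl a' = a ∧ Sum.inl b' = b) ∨
      ∃ i : Fin (k + 1),
        s(a, b) = s(pathVertices x y k i.castSucc, pathVertices x y k i.succ) := by
  rw [joinByPath, sup_adj, fromEdgeSet_adj, map_adj]
  refine or_congr Iff.rfl ⟨fun h => h.1, fun h => ⟨h, ?_⟩⟩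
  rintro rfl
  obtain ⟨i, hi⟩ := h
  have h1 : pathVertices x y k i.castSucc = pathVertices x y k i.succ := by
    rw [Sym2.eq_iff] at hi
    rcases hi with ⟨h1, h2⟩ | ⟨h1, h2⟩ <;> rw [← h1, ← h2]
  have := pathVertices_injective hxy k h1
  simp [Fin.ext_iff] at this

theorem joinByPath_adj_inl {G : SimpleGraph W} {x y a b : W} {k : ℕ} (h : G.Adj a b) :
    (joinByPath G x y k).Adj (Sum.inl a) (Sum.inl b) := by
  rw [joinByPath, sup_adj]
  exact Or.inl ((map_adj _ _ _ _).2 ⟨a, b, h, rfl, rfl⟩)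

theorem joinByPath_adj_path {G : SimpleGraph W} {x y : W} (hxy : x ≠ y) {k : ℕ}
    (i : Fin (k + 1)) : (joinByPath G x y k).Adj (pathVertices x y k i.castSucc)
      (pathVertices x y k i.succ) :=
  (joinByPath_adj hxy).2 (Or.inr ⟨i, rfl⟩)

theorem joinByPath_adj_ends {G : SimpleGraph W} {x y : W} (hxy : x ≠ y) (hadj : ¬ G.Adj x y)
    {k : ℕ} : (joinByPath G x y k).Adj (Sum.inl x) (Sum.inl y) ↔ k = 0 := by
  constructor
  · intro h
    rcases (joinByPath_adj hxy).1 h with ⟨a, b, hab, ha, hb⟩ | ⟨i, hi⟩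
    · cases ha; cases hb; exact absurd hab hadj
    · rw [← pathVertices_zero x y k, ← pathVertices_last x y k, Sym2.eq_iff] at hi
      have inj := pathVertices_injective hxy k
      rcases hi with ⟨h1, h2⟩ | ⟨h1, h2⟩
      · have h1 := congrArg Fin.val (inj h1)
        have h2 := congrArg Fin.val (inj h2)
        rw [Fin.val_castSucc] at h1
        rw [Fin.val_last, Fin.val_succ, ← h1, Fin.val_zero] at h2
        omega
      · exact absurd (inj h1).symm (Fin.succ_ne_zero i)
  · rintro rfl
    exact joinByPath_adj_path hxy 0

theorem joinByPath_connected {G : SimpleGraph W} {x y : W} (hxy : x ≠ y) {k : ℕ}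
    (hG : ∀ w, G.Reachable x w ∨ G.Reachable y w) : (joinByPath G x y k).Connected := by
  have hpath : ∀ i, (joinByPath G x y k).Reachable (Sum.inl x) (pathVertices x y k i) := by
    intro i
    induction i using Fin.induction with
    | zero => rfl
    | succ i ih => exact ih.trans (joinByPath_adj_path hxy i).reachable
  have hmap : ∀ a b, G.Reachable a b → (joinByPath G x y k).Reachable (Sum.inl a) (Sum.inl b) :=
    fun a b h => h.map (⟨Sum.inl, joinByPath_adj_inl⟩ : G →g joinByPath G x y k)
  have hall : ∀ w, (joinByPath G x y k).Reachable (Sum.inl x) w := by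
    rintro (w | j)
    · rcases hG w with h | h
      · exact hmap _ _ h
      · exact (pathVertices_last x y k ▸ hpath (Fin.last _)).trans (hmap _ _ h)
    · exact pathVertices_mid x y k j ▸ hpath j.castSucc.succ
  have : Nonempty (W ⊕ Fin k) := ⟨Sum.inl x⟩
  exact ⟨fun a b => (hall a).symm.trans (hall b)⟩

variable [Fintype W]

theorem joinByPath_ncard_edgeSet_le (G : SimpleGraph W) (x y : W) (k : ℕ) :
    (joinByPath G x y k).edgeSet.ncard ≤ G.edgeSet.ncard + (k + 1) := by
  classical
  have h : (joinByPath G x y k).edgeSet ⊆ Sym2.map Sum.inl '' G.edgeSet ∪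
      Set.range fun i : Fin (k + 1) =>
        s(pathVertices x y k i.castSucc, pathVertices x y k i.succ) := by
    intro e
    induction e with | _ a b
    rw [mem_edgeSet, joinByPath, sup_adj, fromEdgeSet_adj, map_adj]
    rintro (⟨a, b, h, rfl, rfl⟩ | ⟨⟨i, hi⟩, -⟩)
    · exact Or.inl ⟨s(a, b), h, rfl⟩
    · exact Or.inr ⟨i, hi.symm⟩
  refine (Set.ncard_le_ncard h (Set.toFinite _)).trans ((Set.ncard_union_le _ _).trans ?_)
  refine add_le_add (Set.ncard_image_le (Set.toFinite _)) ?_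
  rw [← Set.image_univ]
  exact (Set.ncard_image_le (Set.toFinite _)).trans (by simp)

/-- The neighbour `p` along the path is not one of the two old neighbours: it is either a new vertex
or the other endpoint `z`, not adjacent to `x` in `G`. -/
theorem joinByPath_three_le {G : SimpleGraph W} (hG : ∀ w, valency G w = 2) {x z : W} {k : ℕ}
    {F : SimpleGraph (W ⊕ Fin k)} (hF : ∀ a b, G.Adj a b → F.Adj (Sum.inl a) (Sum.inl b))
    {p : W ⊕ Fin k} (hp : F.Adj (Sum.inl x) p) (hpx : p = Sum.inl z → ¬ G.Adj x z)
    (hpz : (∃ j, p = Sum.inr j) ∨ p = Sum.inl z) : 3 ≤ valency F (Sum.inl x) := by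
  have h1 : p ∉ (Sum.inl : W → W ⊕ Fin k) '' G.neighborSet x := by
    rintro ⟨w, hw, hwp⟩
    rcases hpz with ⟨j, rfl⟩ | rfl
    · cases hwp
    · cases hwp
      exact hpx rfl hw
  have h2 : insert p ((Sum.inl : W → W ⊕ Fin k) '' G.neighborSet x) ⊆ F.neighborSet (Sum.inl x) := by
    rintro q (rfl | ⟨w, hw, rfl⟩)
    · exact hp
    · exact hF _ _ hw
  have h3 := Set.ncard_le_ncard h2 (Set.toFinite _)
  rw [Set.ncard_insert_of_notMem h1 (Set.toFinite _),
    Set.ncard_image_of_injective _ Sum.inl_injective] at h3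
  have := hG x
  unfold valency at *
  omega

/-- Joining two non-adjacent vertices of a `2`-regular graph by a path. -/
theorem joinByPath_isTwoThree {G : SimpleGraph W} {x y : W} (hxy : x ≠ y) (hadj : ¬ G.Adj x y)
    (hG : ∀ w, valency G w = 2) (hr : ∀ w, G.Reachable x w ∨ G.Reachable y w) (k : ℕ) :
    IsTwoThree (joinByPath G x y k) (Sum.inl x) (Sum.inl y) := by
  classical
  set F := joinByPath G x y k with hF
  have hx : 3 ≤ valency F (Sum.inl x) := by
    refine joinByPath_three_le hG (z := y) (fun _ _ => joinByPath_adj_inl)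
      (joinByPath_adj_path hxy 0) (fun _ => hadj) ?_
    rcases pathVertices_cases (Fin.succ (0 : Fin (k + 1))) with h | h | ⟨j, h⟩
    · simp at h
    · rw [h, pathVertices_last]; exact Or.inr rfl
    · rw [h, pathVertices_mid]; exact Or.inl ⟨j, rfl⟩
  have hy : 3 ≤ valency F (Sum.inl y) := by
    have h1 := (joinByPath_adj_path (G := G) hxy (Fin.last k)).symm
    rw [Fin.succ_last, pathVertices_last] at h1
    refine joinByPath_three_le hG (z := x) (fun _ _ => joinByPath_adj_inl) h1
      (fun _ h => hadj h.symm) ?_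
    rcases pathVertices_cases (Fin.castSucc (Fin.last k)) with h | h | ⟨j, h⟩
    · rw [h, pathVertices_zero]; exact Or.inr rfl
    · simp [Fin.ext_iff] at h
    · rw [h, pathVertices_mid]; exact Or.inl ⟨j, rfl⟩
  have hall : ∀ w, 2 ≤ valency F w := by
    rintro (w | j)
    · rw [← hG w, valency, valency, ← Set.ncard_image_of_injective (G.neighborSet w)
        (Sum.inl_injective (β := Fin k))]
      refine Set.ncard_le_ncard ?_ (Set.toFinite _)
      rintro _ ⟨z, hz, rfl⟩
      exact joinByPath_adj_inl hz
    · have h1 := (joinByPath_adj_path (G := G) hxy j.castSucc).symm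
      have h2 := joinByPath_adj_path (G := G) hxy j.succ
      rw [← Fin.succ_castSucc] at h2
      rw [pathVertices_mid] at h1 h2
      have h3 : pathVertices x y k j.castSucc.castSucc ≠ pathVertices x y k j.succ.succ := by
        intro h
        have := pathVertices_injective hxy k h
        simp [Fin.ext_iff] at this
        omega
      rw [valency, ← Set.ncard_pair h3]
      refine Set.ncard_le_ncard ?_ (Set.toFinite _)
      rintro z (rfl | rfl)
      · exact h1
      · exact h2
  have hE : F.edgeSet.ncard ≤ G.edgeSet.ncard + (k + 1) := joinByPath_ncard_edgeSet_le G x y k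
  have hGE := sum_valency G
  simp only [hG, Finset.sum_const, Finset.card_univ, smul_eq_mul] at hGE
  have hFE := sum_valency F
  -- The expected valencies `g` are lower bounds, and their sum is already the largest that the
  -- upper bound on the number of edges allows. So every inequality is an equality.
  set g : W ⊕ Fin k → ℕ := fun w =>
    2 + (if w = Sum.inl x then 1 else 0) + if w = Sum.inl y then 1 else 0 with hg
  have hsum : ∑ w, g w = 2 * (Fintype.card W + k + 1) := by
    simp only [hg, Finset.sum_add_distrib, Finset.sum_ite_eq', Finset.mem_univ, if_true,
      Finset.sum_const, Finset.card_univ, Fintype.card_sum, Fintype.card_fin, smul_eq_mul]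
    ring
  have hle : ∀ w ∈ Finset.univ, g w ≤ valency F w := by
    intro w _
    have := hall w
    by_cases h1 : w = Sum.inl x
    · subst h1
      simp only [hg, if_true, Sum.inl.injEq, hxy, if_false]; omega
    · by_cases h2 : w = Sum.inl y
      · subst h2
        simp only [hg, if_true, Sum.inl.injEq, hxy.symm, if_false]; omega
      · simp only [hg, h1, h2, if_false]; omega
  have heq := (Finset.sum_eq_sum_iff_of_le hle).1 (by
    have := Finset.sum_le_sum hle
    omega)
  refine ⟨joinByPath_connected hxy hr, fun h => hxy (Sum.inl_injective h), ?_, ?_, ?_⟩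
  · rw [← heq _ (Finset.mem_univ _)]; simp [hg, hxy]
  · rw [← heq _ (Finset.mem_univ _)]; simp [hg, hxy.symm]
  · intro w h1 h2
    rw [← heq _ (Finset.mem_univ _)]; simp [hg, h1, h2]

end JoinByPath

/-! ### Dumbbells and theta graphs -/

section Families

theorem valency_cycleGraph {a : ℕ} (ha : 3 ≤ a) (v : Fin a) : valency (cycleGraph a) v = 2 := by
  obtain ⟨m, rfl⟩ : ∃ m, a = m + 3 := ⟨a - 3, by omega⟩
  rw [← degree_eq_valency, cycleGraph_degree_three_le]

/-- Adding an edge is joining by a path without interior vertices. -/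
theorem nonempty_iso_sup_edge {W : Type*} (G : SimpleGraph W) {x y : W} (hxy : x ≠ y) :
    Nonempty ((G ⊔ edge x y) ≃g joinByPath G x y 0) := by
  refine ⟨⟨(Equiv.sumEmpty W (Fin 0)).symm, fun {a b} => ?_⟩⟩
  rw [joinByPath_adj hxy, sup_adj, edge_adj]
  have h0 : pathVertices x y 0 1 = Sum.inl y := pathVertices_last x y 0
  simp [pathVertices_zero, h0]
  refine or_congr_right (iff_self_and.2 ?_)
  rintro (⟨rfl, rfl⟩ | ⟨rfl, rfl⟩)
  · exact hxy
  · exact hxy.symm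

theorem dumbbell_isTwoThree {a b : ℕ} (ha : 3 ≤ a) (hb : 3 ≤ b) (u : Fin a) (v : Fin b) (k : ℕ) :
    IsTwoThree (joinByPath (cycleGraph a ⊕g cycleGraph b) (Sum.inl u) (Sum.inr v) k)
      (Sum.inl (Sum.inl u)) (Sum.inl (Sum.inr v)) := by
  refine joinByPath_isTwoThree (by simp) (by simp) ?_ ?_ k
  · rintro (w | w)
    · rw [valency, neighborSet_sum_inl, Set.ncard_image_of_injective _ Sum.inl_injective]
      exact valency_cycleGraph ha w
    · rw [valency, neighborSet_sum_inr, Set.ncard_image_of_injective _ Sum.inr_injective]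
      exact valency_cycleGraph hb w
  · rintro (w | w)
    · exact Or.inl ((cycleGraph_preconnected u w).map Embedding.sumInl.toHom)
    · exact Or.inr ((cycleGraph_preconnected v w).map Embedding.sumInr.toHom)

theorem theta_isTwoThree {a : ℕ} (ha : 3 ≤ a) {x y : Fin a} (hxy : x ≠ y)
    (hadj : ¬ (cycleGraph a).Adj x y) (k : ℕ) :
    IsTwoThree (joinByPath (cycleGraph a) x y k) (Sum.inl x) (Sum.inl y) :=
  joinByPath_isTwoThree hxy hadj (valency_cycleGraph ha)
    (fun w => Or.inl (cycleGraph_preconnected x w)) k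

end Families

/-! ### Recognising dumbbells and theta graphs -/

section Structure

variable {V : Type*}

/-- The vertices of a cycle, as an injective homomorphism from a cycle graph. -/
theorem exists_cycleGraph_hom {H : SimpleGraph V} {w : V} {p : H.Walk w w} (hp : p.IsCycle) :
    ∃ f : Fin p.length → V, Function.Injective f ∧
      (∀ i j, (cycleGraph p.length).Adj i j → H.Adj (f i) (f j)) ∧
      Set.range f = {x | x ∈ p.support} := by
  have h3 := hp.three_le_length
  -- Subtraction in `Fin` wraps around; the case `j = p.length - 1`, `i = 0` is the closing edge of
  -- the cycle.
  have step : ∀ i j : Fin p.length, (i - j).val = 1 → H.Adj (p.getVert j) (p.getVert i) := by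
    intro i j hij
    rcases le_or_gt j i with hle | hlt
    · rw [Fin.coe_sub_iff_le.2 hle] at hij
      have : (i : ℕ) = j + 1 := by omega
      rw [this]
      exact p.adj_getVert_succ j.2
    · rw [Fin.coe_sub_iff_lt.2 hlt] at hij
      have hj := j.2
      have hi : (i : ℕ) = 0 := by omega
      have hj : (j : ℕ) + 1 = p.length := by omega
      have := p.adj_getVert_succ j.2
      rw [hj, p.getVert_length] at this
      rwa [hi, p.getVert_zero]
  refine ⟨fun i => p.getVert i, fun i j h => ?_, fun i j h => ?_, ?_⟩
  · exact Fin.ext (hp.getVert_injOn' (show (i : ℕ) ≤ _ by omega) (show (j : ℕ) ≤ _ by omega) h)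
  · rcases cycleGraph_adj'.1 h with h | h
    · exact (step i j h).symm
    · exact step j i h
  · ext x
    rw [Set.mem_range, Set.mem_ofPred, Walk.mem_support_iff_exists_getVert]
    constructor
    · rintro ⟨i, rfl⟩
      exact ⟨i, rfl, i.2.le⟩
    · rintro ⟨i, rfl, hi⟩
      rcases hi.lt_or_eq with h | rfl
      · exact ⟨⟨i, h⟩, rfl⟩
      · exact ⟨⟨0, by omega⟩, by simp⟩

/-- When every non-isolated vertex has exactly two neighbours, the component of such a vertex is a
single cycle. -/
theorem IsCycles.exists_cycleGraph_hom [Finite V] {H : SimpleGraph V} (hH : H.IsCycles) {w : V}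
    (hw : (H.neighborSet w).Nonempty) :
    ∃ a, 3 ≤ a ∧ ∃ f : Fin a → V, Function.Injective f ∧
      (∀ i j, (cycleGraph a).Adj i j → H.Adj (f i) (f j)) ∧ ∀ z, z ∈ Set.range f ↔ H.Reachable w z := by
  obtain ⟨p, hp, hv⟩ := hH.exists_cycle_toSubgraph_verts_eq_connectedComponentSupp
    (c := H.connectedComponentMk w) (v := w) rfl hw
  obtain ⟨f, hf, hom, hr⟩ := _root_.exists_cycleGraph_hom hp
  refine ⟨p.length, hp.three_le_length, f, hf, hom, fun z => ?_⟩
  rw [hr, Set.mem_ofPred, ← Walk.mem_verts_toSubgraph, hv, ConnectedComponent.mem_supp_iff,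
    ConnectedComponent.eq]
  exact ⟨Reachable.symm, Reachable.symm⟩

/-- An injective homomorphism matching the vertices of valency `3` is an isomorphism. -/
theorem IsTwoThree.nonempty_iso_of_hom [Finite V] {W : Type*} {F : SimpleGraph W}
    {G : SimpleGraph V} {x y : W} {u v : V} (hF : IsTwoThree F x y) (hG : IsTwoThree G u v)
    {φ : W → V} (hφ : Function.Injective φ) (hom : ∀ a b, F.Adj a b → G.Adj (φ a) (φ b))
    (hx : φ x = u) (hy : φ y = v) : Nonempty (F ≃g G) := by
  have : Nonempty W := ⟨x⟩
  refine nonempty_iso_of_injective_hom hG.connected.preconnected φ hφ hom fun w => ?_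
  by_cases h1 : w = x
  · rw [h1, hF.left, hx, hG.left]
  by_cases h2 : w = y
  · rw [h2, hF.right, hy, hG.right]
  rw [hF.other w h1 h2, hG.other]
  · rw [← hx]; exact hφ.ne h1
  · rw [← hy]; exact hφ.ne h2

/-- A graph consisting of a spanning path between its two vertices of valency `3` and a copy of
`C` is obtained from `C` by joining by a path. -/
theorem IsTwoThree.nonempty_iso_joinByPath [Finite V] {W : Type*} {G : SimpleGraph V} {u v : V}
    (h : IsTwoThree G u v) {P : G.Walk u v} (hP : P.IsPath) {k : ℕ} (hk : P.length = k + 1)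
    {C : SimpleGraph W} {f : W → V} (hf : Function.Injective f)
    (hom : ∀ a b, C.Adj a b → G.Adj (f a) (f b)) {x y : W} (hx : f x = u) (hy : f y = v)
    (hdisj : ∀ w i, 0 < i → i < P.length → f w ≠ P.getVert i)
    (hF : IsTwoThree (joinByPath C x y k) (Sum.inl x) (Sum.inl y)) :
    Nonempty (G ≃g joinByPath C x y k) := by
  have hxy : x ≠ y := fun e => h.ne (by rw [← hx, ← hy, e])
  -- The shift by one skips the start `u` of the path, which is already `f x`.
  set φ : W ⊕ Fin k → V := Sum.elim f fun j => P.getVert (j + 1) with hφ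
  have hpv : ∀ i : Fin (k + 2), φ (pathVertices x y k i) = P.getVert i := by
    intro i
    rcases pathVertices_cases i with rfl | rfl | ⟨j, rfl⟩
    · rw [pathVertices_zero]; simp [hφ, hx]
    · rw [pathVertices_last, Fin.val_last, ← hk, P.getVert_length]; exact hy
    · rw [pathVertices_mid]; simp [hφ]
  have hinj : Function.Injective φ := by
    refine hf.sumElim (fun i j hij => ?_) (fun w j => hdisj w _ (by omega) (by omega))
    have := hP.getVert_injOn (show (i : ℕ) + 1 ≤ _ by omega) (show (j : ℕ) + 1 ≤ _ by omega) hij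
    exact Fin.ext (by omega)
  have hstep : ∀ i : Fin (k + 1), G.Adj (φ (pathVertices x y k i.castSucc))
      (φ (pathVertices x y k i.succ)) := fun i => by
    rw [hpv, hpv, Fin.val_succ]
    exact P.adj_getVert_succ (by rw [hk]; exact i.2)
  obtain ⟨e⟩ := hF.nonempty_iso_of_hom h hinj (fun a b hab => by
      rcases (joinByPath_adj hxy).1 hab with ⟨a, b, hab', rfl, rfl⟩ | ⟨i, hi⟩
      · exact hom a b hab'
      · rw [Sym2.eq_iff] at hi
        rcases hi with ⟨rfl, rfl⟩ | ⟨rfl, rfl⟩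
        · exact hstep i
        · exact (hstep i).symm) hx hy
  exact ⟨e.symm⟩

/-- Deleting the edges of a path between the two vertices of valency `3` leaves valency `0` at
the interior vertices of the path and valency `2` elsewhere. -/
theorem IsTwoThree.valency_deleteEdges [Finite V] {G : SimpleGraph V} {u v : V}
    (h : IsTwoThree G u v) {P : G.Walk u v} (hP : P.IsPath) (w : V) :
    ((∃ i, 0 < i ∧ i < P.length ∧ P.getVert i = w) →
      valency (G.deleteEdges {e | e ∈ P.edges}) w = 0) ∧
    ((∀ i, 0 < i → i < P.length → P.getVert i ≠ w) →
      valency (G.deleteEdges {e | e ∈ P.edges}) w = 2) := by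
  have hnil : ¬ P.Nil := fun hn => h.ne hn.eq
  -- The path uses two edges at an interior vertex, one at each end and none elsewhere, to be
  -- subtracted from `2`, `3` and `2`.
  have hsplit : valency (G.deleteEdges {e | e ∈ P.edges}) w +
      (P.toSubgraph.neighborSet w).ncard = valency G w := by
    rw [valency, valency, ← Set.ncard_union_eq _ (Set.toFinite _) (Set.toFinite _)]
    · congr 1
      ext z
      simp only [Set.mem_union, mem_neighborSet, deleteEdges_adj, Set.mem_ofPred,
        Subgraph.mem_neighborSet, Walk.adj_toSubgraph_iff_mem_edges]
      constructor
      · rintro (h | h)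
        · exact h.1
        · exact P.adj_of_mem_edges h
      · intro h
        by_cases hz : s(w, z) ∈ P.edges
        · exact Or.inr hz
        · exact Or.inl ⟨h, hz⟩
    · rw [Set.disjoint_left]
      intro z hz hz'
      rw [Subgraph.mem_neighborSet, Walk.adj_toSubgraph_iff_mem_edges] at hz'
      simp only [mem_neighborSet, deleteEdges_adj, Set.mem_ofPred] at hz
      exact hz.2 hz'
  have hne : ∀ i, 0 < i → i < P.length → P.getVert i ≠ u ∧ P.getVert i ≠ v := fun i h0 h1 =>
    ⟨fun e => by have := (hP.getVert_eq_start_iff h1.le).1 e; omega,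
      fun e => by have := (hP.getVert_eq_end_iff h1.le).1 e; omega⟩
  constructor
  · rintro ⟨i, h0, h1, rfl⟩
    have := hP.ncard_neighborSet_toSubgraph_internal_eq_two h0.ne' h1
    have := h.other _ (hne i h0 h1).1 (hne i h0 h1).2
    omega
  · intro hw
    by_cases hu : w = u
    · subst hu
      rw [hP.neighborSet_toSubgraph_startpoint hnil, Set.ncard_singleton, h.left] at hsplit
      omega
    by_cases hv : w = v
    · subst hv
      rw [hP.neighborSet_toSubgraph_endpoint hnil, Set.ncard_singleton, h.right] at hsplit
      omega
    have hempty : P.toSubgraph.neighborSet w = ∅ := by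
      rw [Set.eq_empty_iff_forall_notMem]
      intro z hz
      obtain ⟨i, hi, hil⟩ := Walk.mem_support_iff_exists_getVert.1
        (Walk.mem_support_of_adj_toSubgraph (p := P) hz)
      by_cases h0 : i = 0
      · subst h0; rw [P.getVert_zero] at hi; exact hu hi.symm
      by_cases h1 : i = P.length
      · subst h1; rw [P.getVert_length] at hi; exact hv hi.symm
      exact hw i (by omega) (by omega) hi
    rw [hempty, Set.ncard_empty, h.other w hu hv] at hsplit
    omega

/-- A graph with two vertices of valency `3` and all others of valency `2` is two cycles joined by
a path or a cycle with two non-adjacent vertices joined by a path. -/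
theorem IsTwoThree.exists_iso {n : ℕ} {G : SimpleGraph (Fin n)} {u v : Fin n}
    (h : IsTwoThree G u v) : ∃ k, (G.Adj u v ↔ k = 0) ∧
      ((∃ a b, 3 ≤ a ∧ 3 ≤ b ∧ a + b + k = n ∧ ∃ (x : Fin a) (y : Fin b),
        Nonempty (G ≃g joinByPath (cycleGraph a ⊕g cycleGraph b) (Sum.inl x) (Sum.inr y) k)) ∨
      ∃ a, 4 ≤ a ∧ a + k = n ∧ ∃ x y : Fin a, x ≠ y ∧ ¬ (cycleGraph a).Adj x y ∧
        Nonempty (G ≃g joinByPath (cycleGraph a) x y k)) := by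
  classical
  -- A shortest path is needed so that `k = 0` exactly when `u` and `v` are adjacent.
  obtain ⟨P, hP, hd⟩ := (h.connected u v).exists_path_of_dist
  have hpos : 0 < P.length := by
    rw [hd]; exact h.connected.pos_dist_of_ne h.ne
  obtain ⟨k, hk⟩ : ∃ k, P.length = k + 1 := ⟨P.length - 1, by omega⟩
  have hadj : G.Adj u v ↔ k = 0 := by
    rw [← dist_eq_one_iff_adj, ← hd, hk]; omega
  refine ⟨k, hadj, ?_⟩
  set H := G.deleteEdges {e | e ∈ P.edges} with hH
  have hHG : ∀ a b, H.Adj a b → G.Adj a b := fun a b hab => (deleteEdges_adj.1 hab).1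
  have hval := h.valency_deleteEdges hP
  have hcyc : H.IsCycles := by
    intro w hw
    by_cases hi : ∃ i, 0 < i ∧ i < P.length ∧ P.getVert i = w
    · have := (hval w).1 hi
      rw [valency, Set.ncard_eq_zero] at this
      exact absurd this hw.ne_empty
    · push Not at hi
      exact (hval w).2 hi
  have hends : ∀ w, w = u ∨ w = v → (H.neighborSet w).Nonempty := by
    intro w hw
    have : valency H w = 2 := (hval w).2 fun i h0 h1 e => by
      rcases hw with rfl | rfl
      · have := (hP.getVert_eq_start_iff h1.le).1 e; omega
      · have := (hP.getVert_eq_end_iff h1.le).1 e; omega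
    exact Set.nonempty_of_ncard_ne_zero (by unfold valency at this; omega)
  -- Interior vertices of `P` are isolated in `H`, whereas vertices on a cycle of `H` are not.
  have hdisj : ∀ {a : ℕ} (_ : 3 ≤ a) (f : Fin a → Fin n)
      (_ : ∀ i j, (cycleGraph a).Adj i j → H.Adj (f i) (f j)) (w : Fin a) (i : ℕ), 0 < i →
      i < P.length → f w ≠ P.getVert i := by
    intro a ha f hf w i h0 h1 e
    obtain ⟨z, hz⟩ := Set.nonempty_of_ncard_ne_zero (s := (cycleGraph a).neighborSet w) (by
      have := valency_cycleGraph ha w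
      unfold valency at this; omega)
    have h2 := (hval (f w)).1 ⟨i, h0, h1, e.symm⟩
    rw [valency, Set.ncard_eq_zero] at h2
    have : f z ∈ H.neighborSet (f w) := hf _ _ hz
    rw [h2] at this
    exact this
  obtain ⟨a, ha, f, hf, hfom, hfr⟩ := IsCycles.exists_cycleGraph_hom hcyc (hends u (Or.inl rfl))
  obtain ⟨x, hx⟩ := (hfr u).2 (Reachable.refl u)
  by_cases huv : H.Reachable u v
  · right
    obtain ⟨y, hy⟩ := (hfr v).2 huv
    have hxy : x ≠ y := fun e => h.ne (by rw [← hx, ← hy, e])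
    have hnadj : ¬ (cycleGraph a).Adj x y := by
      intro hc
      have hc := hfom _ _ hc
      rw [hx, hy] at hc
      -- If `x` and `y` were adjacent on the cycle, then `P` would be the single edge `uv`, which
      -- was deleted from `H`.
      have h0 := hadj.1 (hHG _ _ hc)
      refine (deleteEdges_adj.1 hc).2 ?_
      have := P.toSubgraph_adj_getVert hpos
      rw [P.getVert_zero, show 0 + 1 = P.length by omega, P.getVert_length,
        Walk.adj_toSubgraph_iff_mem_edges] at this
      exact this
    have hiso := h.nonempty_iso_joinByPath hP hk hf (fun a b hab => hHG _ _ (hfom a b hab)) hx hy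
      (hdisj ha f hfom) (theta_isTwoThree ha hxy hnadj k)
    refine ⟨a, ?_, ?_, x, y, hxy, hnadj, hiso⟩
    · by_contra h4
      obtain rfl : a = 3 := by omega
      rw [cycleGraph_three_eq_top] at hnadj
      exact hnadj hxy
    · obtain ⟨e⟩ := hiso
      have := Fintype.card_congr e.toEquiv
      simp at this
      omega
  · left
    obtain ⟨b, hb, g, hg, hgom, hgr⟩ := IsCycles.exists_cycleGraph_hom hcyc (hends v (Or.inr rfl))
    obtain ⟨y, hy⟩ := (hgr v).2 (Reachable.refl v)
    have hfg : ∀ i j, f i ≠ g j := fun i j e => huv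
      (((hfr _).1 ⟨i, rfl⟩).trans (e ▸ ((hgr _).1 ⟨j, rfl⟩).symm))
    have hiso := h.nonempty_iso_joinByPath hP hk (C := cycleGraph a ⊕g cycleGraph b)
      (f := Sum.elim f g) (x := Sum.inl x) (y := Sum.inr y) (hf.sumElim hg hfg) (by
        rintro (i | i) (j | j) hij
        · exact hHG _ _ (hfom i j (by simpa using hij))
        · simp at hij
        · simp at hij
        · exact hHG _ _ (hgom i j (by simpa using hij))) hx hy (by
        rintro (w | w)
        · exact hdisj ha f hfom w
        · exact hdisj hb g hgom w) (dumbbell_isTwoThree ha hb x y k)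
    refine ⟨a, b, ha, hb, ?_, x, y, hiso⟩
    obtain ⟨e⟩ := hiso
    have := Fintype.card_congr e.toEquiv
    simp at this
    omega

end Structure

/-! ### Uniqueness up to isomorphism for five and six vertices -/

section Uniqueness

/-- A rotation of a cycle graph. -/
def cycleGraphRotation {n : ℕ} (c : Fin (n + 2)) : cycleGraph (n + 2) ≃g cycleGraph (n + 2) where
  toEquiv := Equiv.subRight c
  map_rel_iff' := by simp [cycleGraph_adj]

/-- A reflection of a cycle graph. -/
def cycleGraphReflection {n : ℕ} (c : Fin (n + 2)) :
    cycleGraph (n + 2) ≃g cycleGraph (n + 2) where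
  toEquiv := Equiv.subLeft c
  map_rel_iff' := by simp [cycleGraph_adj, or_comm]

theorem theta_iso_of_iso {a : ℕ} (ha : 3 ≤ a) (f : cycleGraph a ≃g cycleGraph a)
    {x y x' y' : Fin a} (hxy : x ≠ y) (hadj : ¬ (cycleGraph a).Adj x y) (hx : f x = x')
    (hy : f y = y') (k : ℕ) :
    Nonempty (joinByPath (cycleGraph a) x y k ≃g joinByPath (cycleGraph a) x' y' k) := by
  subst hx hy
  have hxy' : f x ≠ f y := f.injective.ne hxy
  have hadj' : ¬ (cycleGraph a).Adj (f x) (f y) := fun h => hadj (f.map_rel_iff.1 h)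
  have hpv : ∀ i, Sum.map f id (pathVertices x y k i) = pathVertices (f x) (f y) k i := by
    intro i
    rcases pathVertices_cases i with rfl | rfl | ⟨j, rfl⟩
    · rfl
    · rw [pathVertices_last, pathVertices_last]; rfl
    · rw [pathVertices_mid, pathVertices_mid]; rfl
  refine (theta_isTwoThree ha hxy hadj k).nonempty_iso_of_hom
    (theta_isTwoThree ha hxy' hadj' k) (φ := Sum.map f id)
    (Sum.map_injective.2 ⟨f.injective, Function.injective_id⟩) (fun p q hpq => ?_) rfl rfl
  rcases (joinByPath_adj hxy).1 hpq with ⟨p, q, h, rfl, rfl⟩ | ⟨i, hi⟩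
  · exact joinByPath_adj_inl (f.map_rel_iff.2 h)
  · refine (joinByPath_adj hxy').2 (Or.inr ⟨i, ?_⟩)
    rw [← hpv, ← hpv, ← Sym2.map_mk, ← Sym2.map_mk, hi]

theorem theta_four_iso {x y : Fin 4} (hxy : x ≠ y) (hadj : ¬ (cycleGraph 4).Adj x y) (k : ℕ) :
    Nonempty (joinByPath (cycleGraph 4) x y k ≃g joinByPath (cycleGraph 4) 0 2 k) := by
  have h : ∀ x y : Fin 4, x ≠ y → ¬ (cycleGraph 4).Adj x y → y - x = 2 := by decide
  exact theta_iso_of_iso (by norm_num) (cycleGraphRotation x) hxy hadj (sub_self x)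
    (h x y hxy hadj) k

theorem theta_five_iso {x y : Fin 5} (hxy : x ≠ y) (hadj : ¬ (cycleGraph 5).Adj x y) (k : ℕ) :
    Nonempty (joinByPath (cycleGraph 5) x y k ≃g joinByPath (cycleGraph 5) 0 2 k) := by
  have h : ∀ x y : Fin 5, x ≠ y → ¬ (cycleGraph 5).Adj x y → y - x = 2 ∨ x - y = 2 := by decide
  rcases h x y hxy hadj with h | h
  · exact theta_iso_of_iso (by norm_num) (cycleGraphRotation x) hxy hadj (sub_self x) h k
  · exact theta_iso_of_iso (by norm_num) (cycleGraphReflection x) hxy hadj (sub_self x) h k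

/-- Both are the theta graph with paths of lengths `2`, `2`, `3` between its branch vertices. The
map `φ` exchanges the added path for an arc of the cycle. -/
theorem theta_four_two_iso_theta_five_one :
    Nonempty (joinByPath (cycleGraph 4) 0 2 2 ≃g joinByPath (cycleGraph 5) 0 2 1) := by
  have h4 := theta_isTwoThree (a := 4) (by norm_num) (x := 0) (y := 2) (by decide) (by decide) 2
  have h5 := theta_isTwoThree (a := 5) (by norm_num) (x := 0) (y := 2) (by decide) (by decide) 1
  have hq : ∀ i : Fin 2, (joinByPath (cycleGraph 5) 0 2 1).Adj (pathVertices 0 2 1 i.castSucc)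
    (pathVertices 0 2 1 i.succ) := fun i => joinByPath_adj_path (by decide) i
  have hq0 : (joinByPath (cycleGraph 5) 0 2 1).Adj (Sum.inl 0) (Sum.inr 0) := hq 0
  have hq1 : (joinByPath (cycleGraph 5) 0 2 1).Adj (Sum.inr 0) (Sum.inl 2) := hq 1
  have hc : ∀ i j : Fin 5, (cycleGraph 5).Adj i j →
      (joinByPath (cycleGraph 5) 0 2 1).Adj (Sum.inl i) (Sum.inl j) :=
    fun i j h => joinByPath_adj_inl h
  set φ : Fin 4 ⊕ Fin 2 → Fin 5 ⊕ Fin 1 :=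
    Sum.elim ![Sum.inl 0, Sum.inl 1, Sum.inl 2, Sum.inr 0] ![Sum.inl 4, Sum.inl 3] with hφ
  refine h4.nonempty_iso_of_hom h5 (φ := φ) (by decide) (fun p q hpq => ?_) rfl rfl
  rcases (joinByPath_adj (by decide)).1 hpq with ⟨p, q, h, rfl, rfl⟩ | ⟨i, hi⟩
  · have step : ∀ p : Fin 4, (joinByPath (cycleGraph 5) 0 2 1).Adj
        (φ (Sum.inl p)) (φ (Sum.inl (p + 1))) := by
      intro p
      fin_cases p
      · exact hc 0 1 (by decide)
      · exact hc 1 2 (by decide)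
      · exact hq1.symm
      · exact hq0.symm
    rcases cycleGraph_adj.1 h with h | h
    · rw [sub_eq_iff_eq_add'.1 h]; exact (step q).symm
    · rw [sub_eq_iff_eq_add'.1 h]; exact step p
  · have step : ∀ i : Fin 3, (joinByPath (cycleGraph 5) 0 2 1).Adj
        (φ (pathVertices 0 2 2 i.castSucc)) (φ (pathVertices 0 2 2 i.succ)) := by
      intro i
      fin_cases i
      · exact hc 0 4 (by decide)
      · exact hc 4 3 (by decide)
      · exact hc 3 2 (by decide)
    rw [Sym2.eq_iff] at hi
    rcases hi with ⟨rfl, rfl⟩ | ⟨rfl, rfl⟩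
    · exact step i
    · exact (step i).symm

theorem uniqueUpToIso_of_iso {V W : Type*} {S : Set (SimpleGraph V)} (T : SimpleGraph W)
    (h : ∀ G ∈ S, Nonempty (G ≃g T)) : UniqueUpToIso S := by
  intro G hG H hH
  obtain ⟨e⟩ := h G hG
  obtain ⟨f⟩ := h H hH
  exact ⟨e.trans f.symm⟩

theorem uniqueUpToIso_familyB31_five : UniqueUpToIso (familyB31 5) := by
  refine uniqueUpToIso_of_iso (joinByPath (cycleGraph 5) 0 2 0) ?_
  rintro G ⟨-, x, y, hxy, hadj, ⟨e⟩⟩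
  obtain ⟨f⟩ := nonempty_iso_sup_edge (cycleGraph 5) hxy
  obtain ⟨g⟩ := theta_five_iso hxy hadj 0
  exact ⟨(e.trans f).trans g⟩

theorem uniqueUpToIso_familyB32_five : UniqueUpToIso (familyB32 5) := by
  refine uniqueUpToIso_of_iso (joinByPath (cycleGraph 4) 0 2 1) ?_
  rintro G ⟨a, ha, ha', x, y, hxy, hadj, ⟨e⟩⟩
  obtain rfl : a = 4 := by omega
  obtain ⟨g⟩ := theta_four_iso hxy hadj 1
  exact ⟨e.trans g⟩

theorem uniqueUpToIso_familyB32_six : UniqueUpToIso (familyB32 6) := by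
  refine uniqueUpToIso_of_iso (joinByPath (cycleGraph 5) 0 2 1) ?_
  rintro G ⟨a, ha, ha', x, y, hxy, hadj, ⟨e⟩⟩
  obtain rfl | rfl : a = 4 ∨ a = 5 := by omega
  · obtain ⟨g⟩ := theta_four_iso hxy hadj 2
    obtain ⟨h⟩ := theta_four_two_iso_theta_five_one
    exact ⟨(e.trans g).trans h⟩
  · obtain ⟨g⟩ := theta_five_iso hxy hadj 1
    exact ⟨e.trans g⟩

end Uniqueness

/-! ### Members of the four families -/

section Nonempty

theorem exists_nonadj_cycleGraph {n : ℕ} (hn : 4 ≤ n) :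
    ∃ x y : Fin n, x ≠ y ∧ ¬ (cycleGraph n).Adj x y := by
  have hlt : (⟨0, by omega⟩ : Fin n) < ⟨2, by omega⟩ := by simp
  refine ⟨⟨0, by omega⟩, ⟨2, by omega⟩, hlt.ne, ?_⟩
  rw [cycleGraph_adj', Fin.coe_sub_iff_lt.2 hlt, Fin.coe_sub_iff_le.2 hlt.le]
  simp
  omega

theorem exists_iso_fin {W : Type*} [Fintype W] (F : SimpleGraph W) {n : ℕ}
    (h : Fintype.card W = n) : ∃ G : SimpleGraph (Fin n), Nonempty (G ≃g F) :=
  ⟨F.overFin h, ⟨(F.overFinIso h).symm⟩⟩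

theorem familyB31_nonempty {n : ℕ} (hn : 4 ≤ n) : (familyB31 n).Nonempty := by
  obtain ⟨x, y, hxy, hadj⟩ := exists_nonadj_cycleGraph hn
  exact ⟨_, hn, x, y, hxy, hadj, ⟨Iso.refl⟩⟩

theorem familyB32_nonempty {n : ℕ} (hn : 5 ≤ n) : (familyB32 n).Nonempty := by
  obtain ⟨x, y, hxy, hadj⟩ := exists_nonadj_cycleGraph (le_refl 4)
  obtain ⟨G, hG⟩ := exists_iso_fin (joinByPath (cycleGraph 4) x y (n - 4)) (n := n)
    (by simp; omega)
  exact ⟨G, 4, le_rfl, hn, x, y, hxy, hadj, hG⟩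

theorem familyB11_nonempty {n : ℕ} (hn : 6 ≤ n) : (familyB11 n).Nonempty := by
  obtain ⟨G, hG⟩ := exists_iso_fin (joinByPath (cycleGraph 3 ⊕g cycleGraph (n - 3))
    (Sum.inl 0) (Sum.inr ⟨0, by omega⟩) 0) (n := n) (by simp; omega)
  exact ⟨G, 3, n - 3, le_rfl, by omega, by omega, _, _, hG⟩

theorem familyB12_nonempty {n : ℕ} (hn : 7 ≤ n) : (familyB12 n).Nonempty := by
  obtain ⟨G, hG⟩ := exists_iso_fin (joinByPath (cycleGraph 3 ⊕g cycleGraph 3)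
    (Sum.inl 0) (Sum.inr 0) (n - 3 - 3)) (n := n) (by simp; omega)
  exact ⟨G, 3, 3, le_rfl, le_rfl, by omega, _, _, hG⟩

end Nonempty

/-! ### The maximum and the second maximum -/

section Main

variable {n : ℕ}

theorem IsTwoThree.exists_of_iso_joinByPath {V W : Type*} {G : SimpleGraph V}
    {C : SimpleGraph W} {x y : W} {k : ℕ} (hxy : x ≠ y) (hadj : ¬ C.Adj x y)
    (h : IsTwoThree (joinByPath C x y k) (Sum.inl x) (Sum.inl y))
    (e : Nonempty (G ≃g joinByPath C x y k)) :
    ∃ u v, IsTwoThree G u v ∧ (G.Adj u v ↔ k = 0) := by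
  obtain ⟨e⟩ := e
  refine ⟨_, _, h.of_iso e.symm, ?_⟩
  rw [e.symm.map_adj_iff, joinByPath_adj_ends hxy hadj]

/-- This translates the families into the `IsTwoThree` condition under which the index is computed;
the joining path has no interior vertices exactly when `u` and `v` are adjacent. -/
theorem mem_familyB11_union_familyB31 {G : SimpleGraph (Fin n)} :
    G ∈ familyB11 n ∪ familyB31 n ↔ ∃ u v, IsTwoThree G u v ∧ G.Adj u v := by
  constructor
  · rintro (⟨a, b, ha, hb, hab, x, y, e⟩ | ⟨hn, x, y, hxy, hadj, ⟨e⟩⟩)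
    · obtain ⟨u, v, h, huv⟩ := IsTwoThree.exists_of_iso_joinByPath (by simp) (by simp)
        (dumbbell_isTwoThree ha hb x y 0) e
      exact ⟨u, v, h, huv.2 rfl⟩
    · obtain ⟨f⟩ := nonempty_iso_sup_edge (cycleGraph n) hxy
      obtain ⟨u, v, h, huv⟩ := IsTwoThree.exists_of_iso_joinByPath hxy hadj
        (theta_isTwoThree (by omega) hxy hadj 0) ⟨e.trans f⟩
      exact ⟨u, v, h, huv.2 rfl⟩
  · rintro ⟨u, v, h, huv⟩
    obtain ⟨k, hk, h | h⟩ := h.exists_iso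
    · obtain rfl := hk.1 huv
      obtain ⟨a, b, ha, hb, hab, x, y, e⟩ := h
      exact Or.inl ⟨a, b, ha, hb, hab, x, y, e⟩
    · obtain rfl := hk.1 huv
      obtain ⟨a, ha, hab, x, y, hxy, hadj, ⟨e⟩⟩ := h
      obtain rfl : a = n := hab
      obtain ⟨f⟩ := nonempty_iso_sup_edge (cycleGraph a) hxy
      exact Or.inr ⟨ha, x, y, hxy, hadj, ⟨e.trans f.symm⟩⟩

theorem mem_familyB12_union_familyB32 {G : SimpleGraph (Fin n)} :
    G ∈ familyB12 n ∪ familyB32 n ↔ ∃ u v, IsTwoThree G u v ∧ ¬ G.Adj u v := by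
  constructor
  · rintro (⟨a, b, ha, hb, hab, x, y, e⟩ | ⟨a, ha, han, x, y, hxy, hadj, e⟩)
    · obtain ⟨u, v, h, huv⟩ := IsTwoThree.exists_of_iso_joinByPath (by simp) (by simp)
        (dumbbell_isTwoThree ha hb x y _) e
      exact ⟨u, v, h, fun h => by have := huv.1 h; omega⟩
    · obtain ⟨u, v, h, huv⟩ := IsTwoThree.exists_of_iso_joinByPath hxy hadj
        (theta_isTwoThree (by omega) hxy hadj _) e
      exact ⟨u, v, h, fun h => by have := huv.1 h; omega⟩
  · rintro ⟨u, v, h, huv⟩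
    obtain ⟨k, hk, h | h⟩ := h.exists_iso
    · have hk := (not_congr hk).1 huv
      obtain ⟨a, b, ha, hb, hab, x, y, e⟩ := h
      obtain rfl : k = n - a - b := by omega
      exact Or.inl ⟨a, b, ha, hb, by omega, x, y, e⟩
    · have hk := (not_congr hk).1 huv
      obtain ⟨a, ha, hab, x, y, hxy, hadj, e⟩ := h
      obtain rfl : k = n - a := by omega
      exact Or.inr ⟨a, ha, by omega, x, y, hxy, hadj, e⟩

theorem IsTwoThree.mem_bicyclicGraphs {G : SimpleGraph (Fin n)} {u v : Fin n}
    (h : IsTwoThree G u v) : G ∈ bicyclicGraphs n :=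
  ⟨h.connected, by simpa using h.ncard_edgeSet⟩

theorem sumConnectivityIndex_of_mem_familyB11_union_familyB31 {G : SimpleGraph (Fin n)}
    (hG : G ∈ familyB11 n ∪ familyB31 n) :
    sumConnectivityIndex G = ((n : ℝ) - 4) / 2 + 1 / √6 + 4 / √5 := by
  classical
  obtain ⟨u, v, h, huv⟩ := mem_familyB11_union_familyB31.1 hG
  rw [h.sumConnectivityIndex_eq, if_pos huv, Fintype.card_fin]
  ring

theorem sumConnectivityIndex_of_mem_familyB12_union_familyB32 {G : SimpleGraph (Fin n)}
    (hG : G ∈ familyB12 n ∪ familyB32 n) :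
    sumConnectivityIndex G = ((n : ℝ) - 5) / 2 + 6 / √5 := by
  classical
  obtain ⟨u, v, h, huv⟩ := mem_familyB12_union_familyB32.1 hG
  rw [h.sumConnectivityIndex_eq, if_neg huv, Fintype.card_fin]
  ring

theorem sumConnectivityIndex_lt_of_notMem (hn : 3 ≤ n) {G : SimpleGraph (Fin n)}
    (hG : G ∈ bicyclicGraphs n) (h1 : G ∉ familyB11 n ∪ familyB31 n)
    (h2 : G ∉ familyB12 n ∪ familyB32 n) :
    sumConnectivityIndex G < ((n : ℝ) - 5) / 2 + 6 / √5 := by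
  rw [mem_familyB11_union_familyB31] at h1
  rw [mem_familyB12_union_familyB32] at h2
  have := sumConnectivityIndex_lt_of_not_isTwoThree hG.1 (by simpa using hG.2) (by simpa using hn)
    (by
      rintro ⟨u, v, h⟩
      by_cases huv : G.Adj u v
      · exact h1 ⟨u, v, h, huv⟩
      · exact h2 ⟨u, v, h, huv⟩)
  rw [Fintype.card_fin] at this
  refine this.trans_eq ?_
  ring

/-- This amounts to `2/√5 < 1/2 + 1/√6`, about `0.894 < 0.908`. -/
theorem second_value_lt_first (n : ℕ) :
    ((n : ℝ) - 5) / 2 + 6 / √5 < ((n : ℝ) - 4) / 2 + 1 / √6 + 4 / √5 := by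
  have h5 := one_div_sqrt_five_le
  have h6 := le_one_div_sqrt_six
  rw [div_eq_mul_one_div 6, div_eq_mul_one_div 4]
  norm_num at *
  linarith

theorem indexMaximizers_eq {V : Type*} [Fintype V] {S F : Set (SimpleGraph V)} {c : ℝ}
    (hFS : F ⊆ S) (hF : F.Nonempty) (hc : ∀ G ∈ F, sumConnectivityIndex G = c)
    (hlt : ∀ G ∈ S, G ∉ F → sumConnectivityIndex G < c) : indexMaximizers S = F := by
  ext G
  constructor
  · rintro ⟨hG, hmax⟩
    by_contra hGF
    obtain ⟨H, hH⟩ := hF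
    have := hmax H (hFS hH)
    rw [hc H hH] at this
    exact absurd (hlt G hG hGF) (not_lt.2 this)
  · intro hG
    refine ⟨hFS hG, fun H hH => ?_⟩
    rw [hc G hG]
    by_cases hHF : H ∈ F
    · exact (hc H hHF).le
    · exact (hlt H hH hHF).le

theorem indexMaximizers_bicyclicGraphs (hn : 5 ≤ n) :
    indexMaximizers (bicyclicGraphs n) = familyB11 n ∪ familyB31 n := by
  refine indexMaximizers_eq (fun G hG => ?_) ((familyB31_nonempty (by omega)).inr)
    (fun G => sumConnectivityIndex_of_mem_familyB11_union_familyB31) fun G hG h1 => ?_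
  · obtain ⟨u, v, h, -⟩ := mem_familyB11_union_familyB31.1 hG
    exact h.mem_bicyclicGraphs
  · by_cases h2 : G ∈ familyB12 n ∪ familyB32 n
    · rw [sumConnectivityIndex_of_mem_familyB12_union_familyB32 h2]
      exact second_value_lt_first n
    · exact (sumConnectivityIndex_lt_of_notMem (by omega) hG h1 h2).trans (second_value_lt_first n)

theorem indexSecondMaximizers_bicyclicGraphs (hn : 5 ≤ n) :
    indexSecondMaximizers (bicyclicGraphs n) = familyB12 n ∪ familyB32 n := by
  rw [indexSecondMaximizers, indexMaximizers_bicyclicGraphs hn]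
  -- The same principle as for the maximum, with the maximizers removed from the set; the two
  -- families are disjoint because their values differ.
  refine indexMaximizers_eq (fun G hG => ⟨?_, fun h1 => ?_⟩) ((familyB32_nonempty hn).inr)
    (fun G => sumConnectivityIndex_of_mem_familyB12_union_familyB32) fun G hG h2 =>
      sumConnectivityIndex_lt_of_notMem (by omega) hG.1 hG.2 h2
  · obtain ⟨u, v, h, -⟩ := mem_familyB12_union_familyB32.1 hG
    exact h.mem_bicyclicGraphs
  · have := second_value_lt_first n
    rw [← sumConnectivityIndex_of_mem_familyB11_union_familyB31 h1,
      ← sumConnectivityIndex_of_mem_familyB12_union_familyB32 hG] at this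
    exact lt_irrefl _ this

theorem familyB11_eq_empty (hn : n < 6) : familyB11 n = ∅ := by
  rw [Set.eq_empty_iff_forall_notMem]
  rintro G ⟨a, b, ha, hb, hab, -⟩
  omega

theorem familyB12_eq_empty (hn : n < 7) : familyB12 n = ∅ := by
  rw [Set.eq_empty_iff_forall_notMem]
  rintro G ⟨a, b, ha, hb, hab, -⟩
  omega

end Main

theorem mainTheorem5 (n : ℕ) (hn : 5 ≤ n) :
    -- extremal graphs for n = 5
    (n = 5 →
      indexMaximizers (bicyclicGraphs n) = familyB31 n ∧
      indexSecondMaximizers (bicyclicGraphs n) = familyB32 n ∧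
      UniqueUpToIso (familyB31 n) ∧ UniqueUpToIso (familyB32 n)) ∧
    -- extremal graphs for n = 6
    (n = 6 →
      indexMaximizers (bicyclicGraphs n) = familyB11 n ∪ familyB31 n ∧
      indexSecondMaximizers (bicyclicGraphs n) = familyB32 n ∧
      UniqueUpToIso (familyB32 n)) ∧
    -- extremal graphs for n ≥ 7
    (7 ≤ n →
      indexMaximizers (bicyclicGraphs n) = familyB11 n ∪ familyB31 n ∧
      indexSecondMaximizers (bicyclicGraphs n) = familyB12 n ∪ familyB32 n) ∧
    -- the extremal values
    (∀ G ∈ familyB11 n ∪ familyB31 n,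
      sumConnectivityIndex G = ((n : ℝ) - 4) / 2 + 1 / √6 + 4 / √5) ∧
    (∀ H ∈ familyB12 n ∪ familyB32 n,
      sumConnectivityIndex H = ((n : ℝ) - 5) / 2 + 6 / √5) ∧
    -- the families are inhabited in the stated ranges of n
    (familyB31 n).Nonempty ∧ (familyB32 n).Nonempty ∧
    (6 ≤ n → (familyB11 n).Nonempty) ∧ (7 ≤ n → (familyB12 n).Nonempty) := by
  have hmax := indexMaximizers_bicyclicGraphs hn
  have hsec := indexSecondMaximizers_bicyclicGraphs hn
  refine ⟨?_, ?_, fun _ => ⟨hmax, hsec⟩,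
    fun G => sumConnectivityIndex_of_mem_familyB11_union_familyB31,
    fun G => sumConnectivityIndex_of_mem_familyB12_union_familyB32,
    familyB31_nonempty (by omega), familyB32_nonempty hn, familyB11_nonempty,
    familyB12_nonempty⟩
  · rintro rfl
    rw [familyB11_eq_empty (by norm_num), Set.empty_union] at hmax
    rw [familyB12_eq_empty (by norm_num), Set.empty_union] at hsec
    exact ⟨hmax, hsec, uniqueUpToIso_familyB31_five, uniqueUpToIso_familyB32_five⟩
  · rintro rfl
    rw [familyB12_eq_empty (by norm_num), Set.empty_union] at hsec
    exact ⟨hmax, hsec, uniqueUpToIso_familyB32_six⟩
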